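/- Let $(\mathcal P,\mathcal L)$ be a Desargues affine plane: $\mathcal L$ is a set of subsets of $\mathcal P$ (lines) such that two distinct points lie on exactly one line; for every line $\ell$ and every point $P\notin\ell$ there is exactly one line through $P$ disjoint from $\ell$; there are three non-collinear points; and Desargues' axiom holds, that is, if the lines $AA',BB',CC'$ are distinct and are either mutually parallel or concurrent in one point, and $AB\parallel A'B'$, $BC\parallel B'C'$ (with $A,B,C$ distinct, $A',B',C'$ distinct, $A\ne A'$, $B\ne B'$, $C\ne C'$, and $AA',BB',CC',AC,A'C'$ pairwise distinct, $AB\neq A'B'$, $BC\ne B'C'$), then $AC\parallel A'C'$. (Lines are parallel if they are equal or disjoint.) Let $O\neq I$ be points. The points of the line $\ell^{OI}$ are added and multiplied as follows. Choose $B_1\notin \ell^{OI}$. For the sum, let $P_1$ be the meet of the parallel to $OI$ through $B_1$ with the parallel to $OB_1$ through $A$; for the product, let $P_1$ be the meet of the parallel to $IB_1$ through $A$ with the line $OB_1$. In both cases the result ($A+B$, respectively $A\cdot B$) is the meet of the parallel to $BB_1$ through $P_1$ with $\ell^{OI}$. Write $-A$ for the point with $A+(-A)=(-A)+A=O$, put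 $A-B=A+(-B)$, write $A^{-1}$ for the point with $A A^{-1}=A^{-1}A=I$ if $A\neq O$, and put $O^{-1}=O$ by convention. The cross-ratio of points of $\ell^{OI}$ is $$c_r(A,B;C,D)=\left[(A-D)^{-1}(B-D)\right]\left[(B-C)^{-1}(A-C)\right].$$ Theorem. Let $A,C,D\in\ell^{OI}$ be three distinct points, all different from $O$. Put $f_B(X)=c_r(A,X;C,D)$ for $X\in\ell^{OI}$ and $\mathcal R^B_4=\{f_B(X) : X\in\ell^{OI}\}$. Then addition of points, applied to elements of $\mathcal R^B_4$, has the following properties. 1. It is associative: $(U+V)+W=U+(V+W)$ for all $U,V,W\in\mathcal R^B_4$. 2. It is commutative: $U+V=V+U$ for all $U,V\in\mathcal R^B_4$. 3. It has a zero element in $\mathcal R^B_4$: one has $f_B(D)=O$, and, with the convention $O^{-1}=O$, also $f_B(C)=O$; thus $O\in\mathcal R^B_4$, and $U+O=O+U=U$ for all $U\in\mathcal R^B_4$. (The sums are points of $\ell^{OI}$; it is not claimed that they belong to $\mathcal R^B_4$.) -/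

import Mathlib

/-- An affine plane on the point set `P`: lines are sets of points, two distinct points lie on
exactly one line, Playfair's parallel axiom holds, and there are three non-collinear points. -/
structure AffinePlane (P : Type*) where
  lines : Set (Set P)
  existsUnique_line : ∀ A B : P, A ≠ B → ∃! l : Set P, l ∈ lines ∧ A ∈ l ∧ B ∈ l
  playfair : ∀ A : P, ∀ l ∈ lines, A ∉ l → ∃! m : Set P, m ∈ lines ∧ A ∈ m ∧ l ∩ m = ∅
  exists_noncollinear : ∃ A B C : P, A ≠ B ∧ A ≠ C ∧ B ≠ C ∧
    ¬ ∃ l ∈ lines, A ∈ l ∧ B ∈ l ∧ C ∈ l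

namespace AffinePlane

variable {P : Type*} (S : AffinePlane P)

/-- The line through `A` and `B` (meant for `A ≠ B`, where exactly one line contains both). -/
def join (A B : P) : Set P := {X | ∃ l ∈ S.lines, A ∈ l ∧ B ∈ l ∧ X ∈ l}

/-- Two lines are parallel if they are equal or have no common point. -/
def Parallel (l m : Set P) : Prop := l = m ∨ l ∩ m = ∅

/-- The line through `A` parallel to the line `l`. -/
def parallelThrough (l : Set P) (A : P) : Set P :=
  {X | ∃ m ∈ S.lines, Parallel l m ∧ A ∈ m ∧ X ∈ m}

/-- Desargues' axiom, for both triangles in perspective from parallel lines and triangles in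
perspective from a point. -/
def IsDesarguesian : Prop :=
  ∀ A B C A' B' C' : P,
    A ≠ A' → B ≠ B' → C ≠ C' →
    A ≠ B → A' ≠ B' → B ≠ C → B' ≠ C' → A ≠ C → A' ≠ C' →
    [S.join A A', S.join B B', S.join C C', S.join A C, S.join A' C'].Nodup →
    S.join A B ≠ S.join A' B' → S.join B C ≠ S.join B' C' →
    ((Parallel (S.join A A') (S.join B B') ∧ Parallel (S.join B B') (S.join C C') ∧
        Parallel (S.join A A') (S.join C C')) ∨
      ∃ V : P, S.join A A' ∩ S.join B B' ∩ S.join C C' = {V}) →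
    Parallel (S.join A B) (S.join A' B') → Parallel (S.join B C) (S.join B' C') →
    Parallel (S.join A C) (S.join A' C')

/-! ### Basic incidence facts -/

theorem join_eq {A B : P} (hAB : A ≠ B) {l : Set P} (hl : l ∈ S.lines) (hA : A ∈ l)
    (hB : B ∈ l) : S.join A B = l := by
  ext X
  constructor
  · rintro ⟨m, hm, hAm, hBm, hX⟩
    rwa [(S.existsUnique_line A B hAB).unique ⟨hl, hA, hB⟩ ⟨hm, hAm, hBm⟩]
  · exact fun hX => ⟨l, hl, hA, hB, hX⟩

theorem join_mem_lines {A B : P} (hAB : A ≠ B) : S.join A B ∈ S.lines := by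
  obtain ⟨l, ⟨hl, hA, hB⟩, -⟩ := S.existsUnique_line A B hAB
  rwa [S.join_eq hAB hl hA hB]

theorem left_mem_join {A B : P} (hAB : A ≠ B) : A ∈ S.join A B := by
  obtain ⟨l, ⟨hl, hA, hB⟩, -⟩ := S.existsUnique_line A B hAB
  exact ⟨l, hl, hA, hB, hA⟩

theorem right_mem_join {A B : P} (hAB : A ≠ B) : B ∈ S.join A B := by
  obtain ⟨l, ⟨hl, hA, hB⟩, -⟩ := S.existsUnique_line A B hAB
  exact ⟨l, hl, hA, hB, hB⟩

/-- Through every point there is exactly one parallel to a given line. -/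
theorem existsUnique_parallel {l : Set P} (hl : l ∈ S.lines) (A : P) :
    ∃! m : Set P, m ∈ S.lines ∧ Parallel l m ∧ A ∈ m := by
  by_cases hA : A ∈ l
  · refine ⟨l, ⟨hl, Or.inl rfl, hA⟩, ?_⟩
    rintro m ⟨-, rfl | hd, hAm⟩
    · rfl
    · exact absurd (show A ∈ l ∩ m from ⟨hA, hAm⟩) (by simp [hd])
  · obtain ⟨m, ⟨hm, hAm, hd⟩, huniq⟩ := S.playfair A l hl hA
    refine ⟨m, ⟨hm, Or.inr hd, hAm⟩, ?_⟩
    rintro k ⟨hk, rfl | hdk, hAk⟩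
    · exact absurd hAk hA
    · exact huniq k ⟨hk, hAk, hdk⟩

theorem parallelThrough_eq {l m : Set P} (hl : l ∈ S.lines) (hm : m ∈ S.lines)
    (hp : Parallel l m) {A : P} (hA : A ∈ m) : S.parallelThrough l A = m := by
  ext X
  constructor
  · rintro ⟨k, hk, hpk, hAk, hX⟩
    rwa [(S.existsUnique_parallel hl A).unique ⟨hm, hp, hA⟩ ⟨hk, hpk, hAk⟩]
  · exact fun hX => ⟨m, hm, hp, hA, hX⟩

/-- If `m` is not parallel to `l`, the parallel to `m` through any point meets every parallel
to `l`. -/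
theorem exists_mem_inter {l m l' : Set P} (hl : l ∈ S.lines) (hm : m ∈ S.lines)
    (hl' : l' ∈ S.lines) (hll' : Parallel l l') (hlm : ¬ Parallel l m) (A : P) :
    ∃ X, X ∈ l' ∧ X ∈ S.parallelThrough m A := by
  obtain ⟨m', ⟨hm', hmm', hA⟩, -⟩ := S.existsUnique_parallel hm A
  rw [S.parallelThrough_eq hm hm' hmm' hA]
  by_contra hcon
  have hd : Parallel l' m' := by
    right
    ext X
    simp only [Set.mem_inter_iff, Set.mem_empty_iff_false, iff_false]
    exact fun h => hcon ⟨X, h⟩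
  have symm : ∀ {a b : Set P}, Parallel a b → Parallel b a := by
    rintro a b (rfl | h)
    · exact Or.inl rfl
    · exact Or.inr (by rwa [Set.inter_comm])
  have trans : ∀ {a b c : Set P}, a ∈ S.lines → b ∈ S.lines → c ∈ S.lines →
      Parallel a b → Parallel b c → Parallel a c := by
    intro a b c ha hb hc hab hbc
    by_cases h : (a ∩ c).Nonempty
    · obtain ⟨X, hXa, hXc⟩ := h
      exact Or.inl ((S.existsUnique_parallel hb X).unique ⟨ha, symm hab, hXa⟩ ⟨hc, hbc, hXc⟩)
    · exact Or.inr (Set.not_nonempty_iff_eq_empty.mp h)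
  exact hlm (trans hl hl' hm hll' (trans hl' hm' hm hd (symm hmm')))

theorem exists_notMem {l : Set P} (hl : l ∈ S.lines) : ∃ X, X ∉ l := by
  obtain ⟨A, B, C, -, -, -, h⟩ := S.exists_noncollinear
  by_contra hcon
  push Not at hcon
  exact h ⟨l, hl, hcon A, hcon B, hcon C⟩

theorem not_parallel {l m : Set P} {X Y : P} (hX : X ∈ l) (hXm : X ∈ m) (hY : Y ∉ l)
    (hYm : Y ∈ m) : ¬ Parallel l m := by
  rintro (rfl | hd)
  · exact hY hYm
  · exact absurd (show X ∈ l ∩ m from ⟨hX, hXm⟩) (by simp [hd])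

/-- Two distinct base points `O` and `I`. -/
structure Frame {P : Type*} (S : AffinePlane P) where
  O : P
  I : P
  ne : O ≠ I

namespace Frame

variable {S} (F : S.Frame)

/-- The line `OI` as a set of points. -/
def carrier : Set P := S.join F.O F.I

/-- The type of the points of the line `OI`. -/
def Point : Type _ := {X : P // X ∈ F.carrier}

variable {F}

/-- The point `O`. -/
instance : Zero F.Point := ⟨⟨F.O, S.left_mem_join F.ne⟩⟩

/-- The point `I`. -/
instance : One F.Point := ⟨⟨F.I, S.right_mem_join F.ne⟩⟩

instance : Nonempty F.Point := ⟨0⟩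

/-- `C` results from the addition construction for `A` and `B`: take `B₁` off the line `OI`; let
`P₁` be the meet of the parallel to `OI` through `B₁` and the parallel to `OB₁` through `A`;
then `C` is the meet of the parallel to `BB₁` through `P₁` with the line `OI`. -/
def IsSum (A B C : F.Point) : Prop :=
  ∃ B₁ P₁ : P, B₁ ∉ F.carrier ∧
    P₁ ∈ S.parallelThrough F.carrier B₁ ∩ S.parallelThrough (S.join F.O B₁) A.1 ∧
    C.1 ∈ S.parallelThrough (S.join B.1 B₁) P₁ ∩ F.carrier

/-- `C` results from the multiplication construction for `A` and `B`: take `B₁` off the line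
`OI`; let `P₁` be the meet of the parallel to `IB₁` through `A` and the line `OB₁`; then `C` is
the meet of the parallel to `BB₁` through `P₁` with the line `OI`. -/
def IsProd (A B C : F.Point) : Prop :=
  ∃ B₁ P₁ : P, B₁ ∉ F.carrier ∧
    P₁ ∈ S.parallelThrough (S.join F.I B₁) A.1 ∩ S.join F.O B₁ ∧
    C.1 ∈ S.parallelThrough (S.join B.1 B₁) P₁ ∩ F.carrier

theorem carrier_mem_lines : F.carrier ∈ S.lines := S.join_mem_lines F.ne

theorem exists_last (B : F.Point) {B₁ : P} (h : B₁ ∉ F.carrier) (P₁ : P) :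
    ∃ C : F.Point, C.1 ∈ S.parallelThrough (S.join B.1 B₁) P₁ ∩ F.carrier := by
  have hne : B.1 ≠ B₁ := fun e => h (e ▸ B.2)
  obtain ⟨C, hC, hC'⟩ := S.exists_mem_inter (l := F.carrier) carrier_mem_lines
    (S.join_mem_lines hne) carrier_mem_lines (Or.inl rfl)
    (not_parallel B.2 (S.left_mem_join hne) h (S.right_mem_join hne)) P₁
  exact ⟨⟨C, hC⟩, hC', hC⟩

theorem exists_isSum (A B : F.Point) : ∃ C, IsSum A B C := by
  obtain ⟨B₁, h⟩ := S.exists_notMem (carrier_mem_lines (F := F))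
  have hO : F.O ∈ F.carrier := S.left_mem_join F.ne
  have hne : F.O ≠ B₁ := fun e => h (e ▸ hO)
  obtain ⟨l', ⟨hl', hp, hB₁⟩, -⟩ := S.existsUnique_parallel (carrier_mem_lines (F := F)) B₁
  obtain ⟨P₁, h1, h2⟩ := S.exists_mem_inter carrier_mem_lines
    (S.join_mem_lines hne) hl' hp
    (not_parallel hO (S.left_mem_join hne) h (S.right_mem_join hne)) A.1
  obtain ⟨C, hC⟩ := exists_last B h P₁
  exact ⟨C, B₁, P₁, h, ⟨⟨l', hl', hp, hB₁, h1⟩, h2⟩, hC⟩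

theorem exists_isProd (A B : F.Point) : ∃ C, IsProd A B C := by
  obtain ⟨B₁, h⟩ := S.exists_notMem (carrier_mem_lines (F := F))
  have hO : F.O ∈ F.carrier := S.left_mem_join F.ne
  have hI : F.I ∈ F.carrier := S.right_mem_join F.ne
  have hne : F.O ≠ B₁ := fun e => h (e ▸ hO)
  have hne' : F.I ≠ B₁ := fun e => h (e ▸ hI)
  have hne2 : F.I ∉ S.join F.O B₁ := by
    intro hmem
    apply h
    rw [carrier, S.join_eq F.ne (S.join_mem_lines hne) (S.left_mem_join hne) hmem]
    exact S.right_mem_join hne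
  obtain ⟨P₁, h1, h2⟩ := S.exists_mem_inter (S.join_mem_lines hne) (S.join_mem_lines hne')
    (S.join_mem_lines hne) (Or.inl rfl)
    (not_parallel (S.right_mem_join hne) (S.right_mem_join hne') hne2 (S.left_mem_join hne')) A.1
  obtain ⟨C, hC⟩ := exists_last B h P₁
  exact ⟨C, B₁, P₁, h, ⟨h2, h1⟩, hC⟩

/-- Addition of points of the line `OI`: the result of the addition construction. -/
noncomputable instance : Add F.Point := ⟨fun A B => Classical.choose (exists_isSum A B)⟩

/-- Multiplication of points of the line `OI`: the result of the multiplication construction. -/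
noncomputable instance : Mul F.Point := ⟨fun A B => Classical.choose (exists_isProd A B)⟩

/-- The opposite of a point with respect to addition of points. -/
noncomputable instance : Neg F.Point :=
  ⟨fun A => Classical.epsilon fun Z => A + Z = 0 ∧ Z + A = 0⟩

/-- Subtraction of points. -/
noncomputable instance : Sub F.Point := ⟨fun A B => A + -B⟩

open Classical in
/-- The inverse of a point with respect to multiplication of points, with the convention
`O⁻¹ = O`. -/
noncomputable instance : Inv F.Point :=
  ⟨fun A => if A = 0 then 0 else Classical.epsilon fun Z => A * Z = 1 ∧ Z * A = 1⟩

/-- The cross-ratio `c_r(A, B; C, D)` of points of the line `OI`. -/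
noncomputable def crossRatio (A B C D : F.Point) : F.Point :=
  ((A - D)⁻¹ * (B - D)) * ((B - C)⁻¹ * (A - C))

/-- The map `X ↦ c_r(A, X; C, D)`. -/
noncomputable def fB (A C D : F.Point) (X : F.Point) : F.Point := crossRatio A X C D

/-- The cross-ratio map set `{c_r(A, X; C, D) | X ∈ OI}`. -/
def mapSetB (A C D : F.Point) : Set F.Point := Set.range (fB A C D)

end Frame

end AffinePlane

namespace AffinePlane

variable {P : Type*} {S : AffinePlane P}

/-! The additive laws hold on the whole line `OI`; the cross-ratio matters only for the two values
that equal `O`. Adding `A` on the left is the translation along `OI` that takes `O` to `A`. Such a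
translation is encoded by a pair `Q`, `R` on a parallel to `OI`, and it takes `X` to `Y` when `XQ`
and `YR` are parallel (`Shift`). The parallel case of Desargues' axiom shows that the translation
does not depend on the pair (`Shift.transfer`), so sums may be computed with any convenient pair.

Associativity is then the composition of translations, chained through `Q`, `R`, `T`. Commutativity
takes two more uses of the parallel case, around an auxiliary parallelogram (`point_add_comm`).

For the zero, `fB` at `D` has the factor `D - D`, and at `C` the factor `(C - C)⁻¹`, which is `O` by
convention. Products with `O` are `O` for every choice of the auxiliary point, so independence of
choices is never needed for multiplication. -/

/-! ### Parallels, transversals and the little Desargues theorem -/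

theorem Parallel.refl (l : Set P) : Parallel l l := Or.inl rfl

theorem Parallel.symm {l m : Set P} (h : Parallel l m) : Parallel m l := by
  rcases h with rfl | h
  · exact Or.inl rfl
  · exact Or.inr (by rwa [Set.inter_comm])

theorem Parallel.eq_of_mem {l m : Set P} (h : Parallel l m) {X : P} (hl : X ∈ l) (hm : X ∈ m) :
    l = m := by
  rcases h with h | h
  · exact h
  · exact absurd (show X ∈ l ∩ m from ⟨hl, hm⟩) (by simp [h])

theorem parallel_of_forall_eq {l m : Set P} (h : ∀ X, X ∈ l → X ∈ m → l = m) : Parallel l m := by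
  by_cases hne : (l ∩ m).Nonempty
  · obtain ⟨X, hX, hX'⟩ := hne
    exact Or.inl (h X hX hX')
  · exact Or.inr (Set.not_nonempty_iff_eq_empty.mp hne)

theorem Parallel.trans {l m n : Set P} (hl : l ∈ S.lines) (hm : m ∈ S.lines) (hn : n ∈ S.lines)
    (h : Parallel l m) (h' : Parallel m n) : Parallel l n :=
  parallel_of_forall_eq fun X hX hX' =>
    (S.existsUnique_parallel hm X).unique ⟨hl, h.symm, hX⟩ ⟨hn, h', hX'⟩

theorem line_eq {l m : Set P} {X Y : P} (hXY : X ≠ Y) (hl : l ∈ S.lines) (hm : m ∈ S.lines)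
    (hX : X ∈ l) (hY : Y ∈ l) (hX' : X ∈ m) (hY' : Y ∈ m) : l = m :=
  (S.join_eq hXY hl hX hY).symm.trans (S.join_eq hXY hm hX' hY')

theorem join_comm (X Y : P) : S.join X Y = S.join Y X := by
  ext Z
  constructor <;> rintro ⟨l, hl, h1, h2, h3⟩ <;> exact ⟨l, hl, h2, h1, h3⟩

theorem ne_of_mem_of_parallel {l m : Set P} (h : Parallel l m) (hne : l ≠ m) {X Y : P}
    (hX : X ∈ l) (hY : Y ∈ m) : X ≠ Y := by
  rintro rfl
  exact hne (h.eq_of_mem hX hY)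

/-- A line meets each of two distinct parallels at most once, if it meets both. -/
theorem eq_of_mem_transversal {l m t : Set P} (hm : m ∈ S.lines) (ht : t ∈ S.lines)
    (h : Parallel l m) (hne : l ≠ m) {X Y Z : P} (hX : X ∈ l) (hY : Y ∈ m) (hZ : Z ∈ m)
    (hXt : X ∈ t) (hYt : Y ∈ t) (hZt : Z ∈ t) : Y = Z := by
  by_contra hYZ
  have := line_eq hYZ hm ht hY hZ hYt hZt
  subst this
  exact hne (h.eq_of_mem hX hXt)

theorem eq_of_parallel_join {l m : Set P} (hm : m ∈ S.lines) (h : Parallel l m) (hne : l ≠ m)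
    {X Y Z : P} (hX : X ∈ l) (hY : Y ∈ m) (hZ : Z ∈ m)
    (hp : Parallel (S.join X Y) (S.join X Z)) : Y = Z := by
  have hXY := ne_of_mem_of_parallel h hne hX hY
  have hXZ := ne_of_mem_of_parallel h hne hX hZ
  have he := hp.eq_of_mem (S.left_mem_join hXY) (S.left_mem_join hXZ)
  exact eq_of_mem_transversal hm (S.join_mem_lines hXY) h hne hX hY hZ (S.left_mem_join hXY)
    (S.right_mem_join hXY) (he ▸ S.right_mem_join hXZ)

theorem join_ne_join_of_parallel {l m : Set P} (hm : m ∈ S.lines) (h : Parallel l m)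
    (hne : l ≠ m) {X X' Y Y' : P} (hX : X ∈ l) (hX' : X' ∈ l) (hY : Y ∈ m) (hY' : Y' ∈ m)
    (hYY : Y ≠ Y') : S.join X Y ≠ S.join X' Y' := fun he => by
  have hXY := ne_of_mem_of_parallel h hne hX hY
  exact hYY (eq_of_mem_transversal hm (S.join_mem_lines hXY) h hne hX hY hY'
    (S.left_mem_join hXY) (S.right_mem_join hXY)
    (he ▸ S.right_mem_join (ne_of_mem_of_parallel h hne hX' hY')))

/-- The parallel case of the axiom, freed of its nondegeneracy conditions: these follow from the
distinctness of the three parallels, except when a vertex is fixed. -/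
theorem little_desargues (hS : S.IsDesarguesian) {l m n : Set P} (hl : l ∈ S.lines)
    (hm : m ∈ S.lines) (hn : n ∈ S.lines) (plm : Parallel l m) (pmn : Parallel m n)
    (hlm : l ≠ m) (hmn : m ≠ n) (hln : l ≠ n) {A A' B B' C C' : P} (hA : A ∈ l) (hA' : A' ∈ l)
    (hB : B ∈ m) (hB' : B' ∈ m) (hC : C ∈ n) (hC' : C' ∈ n)
    (hAB : Parallel (S.join A B) (S.join A' B')) (hBC : Parallel (S.join B C) (S.join B' C')) :
    Parallel (S.join A C) (S.join A' C') := by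
  have pln := plm.trans hl hm hn pmn
  -- One fixed vertex forces all three to be fixed, since a point and a direction determine the meet
  -- with a parallel.
  by_cases hBB : B = B'
  · subst hBB
    rw [join_comm A B, join_comm A' B] at hAB
    rw [eq_of_parallel_join hl plm.symm hlm.symm hB hA hA' hAB,
      eq_of_parallel_join hn pmn hmn hB hC hC' hBC]
    exact Parallel.refl _
  have hAA : A ≠ A' := by
    rintro rfl
    exact hBB (eq_of_parallel_join hm plm hlm hA hB hB' hAB)
  have hCC : C ≠ C' := by
    rintro rfl
    rw [join_comm B C, join_comm B' C] at hBC
    exact hBB (eq_of_parallel_join hm pmn.symm hmn.symm hC hB hB' hBC)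
  have nAB := ne_of_mem_of_parallel plm hlm hA hB
  have nAB' := ne_of_mem_of_parallel plm hlm hA' hB'
  have nBC := ne_of_mem_of_parallel pmn hmn hB hC
  have nBC' := ne_of_mem_of_parallel pmn hmn hB' hC'
  have nAC := ne_of_mem_of_parallel pln hln hA hC
  have nAC' := ne_of_mem_of_parallel pln hln hA' hC'
  have eA := S.join_eq hAA hl hA hA'
  have eB := S.join_eq hBB hm hB hB'
  have eC := S.join_eq hCC hn hC hC'
  -- A transversal from `l` to `n` is none of the three parallels, as the distinctness list in the
  -- axiom requires.
  have notMem : ∀ {X Y : P}, X ∈ l → Y ∈ n → X ≠ Y →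
      l ≠ S.join X Y ∧ m ≠ S.join X Y ∧ n ≠ S.join X Y := by
    intro X Y hX hY hXY
    refine ⟨fun e => ?_, fun e => ?_, fun e => ?_⟩
    · exact hln (pln.eq_of_mem (e ▸ S.right_mem_join hXY : Y ∈ l) hY)
    · exact hlm (plm.eq_of_mem hX (e ▸ S.left_mem_join hXY : X ∈ m))
    · exact hln (pln.eq_of_mem hX (e ▸ S.left_mem_join hXY : X ∈ n))
  obtain ⟨h1, h2, h3⟩ := notMem hA hC nAC
  obtain ⟨h1', h2', h3'⟩ := notMem hA' hC' nAC'
  refine hS A B C A' B' C' hAA hBB hCC nAB nAB' nBC nBC' nAC nAC' ?_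
    (join_ne_join_of_parallel hm plm hlm hA hA' hB hB' hBB)
    (join_ne_join_of_parallel hn pmn hmn hB hB' hC hC' hCC) (Or.inl ?_) hAB hBC
  · rw [eA, eB, eC]
    have := join_ne_join_of_parallel hn pln hln hA hA' hC hC' hCC
    simp [*]
  · rw [eA, eB, eC]
    exact ⟨plm, pmn, pln⟩

/-! ### Translations along the line `OI` -/

namespace Frame

variable {F : S.Frame}

theorem ne_of_notMem_carrier (X : F.Point) {Q : P} (h : Q ∉ F.carrier) : X.1 ≠ Q :=
  fun e => h (e ▸ X.2)

/-- The translation along the line `OI` taking `X` to `Y` takes `Q`, off that line, to `R`. -/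
def Shift (X Y : F.Point) (Q R : P) : Prop :=
  Q ∉ F.carrier ∧ R ∈ S.parallelThrough F.carrier Q ∧ Parallel (S.join X.1 Q) (S.join Y.1 R)

theorem exists_parallel_of_notMem {Q : P} (h : Q ∉ F.carrier) : ∃ m ∈ S.lines,
    Parallel F.carrier m ∧ F.carrier ≠ m ∧ S.parallelThrough F.carrier Q = m ∧ Q ∈ m := by
  obtain ⟨m, ⟨hm, hp, hQ⟩, -⟩ := S.existsUnique_parallel (carrier_mem_lines (F := F)) Q
  exact ⟨m, hm, hp, fun e => h (e ▸ hQ), S.parallelThrough_eq carrier_mem_lines hm hp hQ, hQ⟩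

theorem notMem_carrier_of_mem_parallelThrough {Q R : P} (h : Q ∉ F.carrier)
    (hR : R ∈ S.parallelThrough F.carrier Q) : R ∉ F.carrier := by
  obtain ⟨m, hm, hp, hne, he, hQ⟩ := exists_parallel_of_notMem h
  rw [he] at hR
  exact fun hR' => hne (hp.eq_of_mem hR' hR)

theorem Shift.right_notMem {X Y : F.Point} {Q R : P} (h : Shift X Y Q R) : R ∉ F.carrier :=
  notMem_carrier_of_mem_parallelThrough h.1 h.2.1

theorem mem_parallelThrough_join_iff {X Y : F.Point} {Q R : P}
    (hR : R ∉ F.carrier) :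
    R ∈ S.parallelThrough (S.join X.1 Q) Y.1 ↔ Parallel (S.join X.1 Q) (S.join Y.1 R) := by
  have hY := ne_of_notMem_carrier Y hR
  constructor
  · rintro ⟨m, hm, hp, hYm, hRm⟩
    rwa [S.join_eq hY hm hYm hRm]
  · exact fun h => ⟨_, S.join_mem_lines hY, h, S.left_mem_join hY, S.right_mem_join hY⟩

theorem mem_parallelThrough_join_iff' {X Y : F.Point} {Q R : P}
    (hR : R ∉ F.carrier) :
    Y.1 ∈ S.parallelThrough (S.join X.1 Q) R ↔ Parallel (S.join X.1 Q) (S.join Y.1 R) := by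
  have hY := ne_of_notMem_carrier Y hR
  constructor
  · rintro ⟨m, hm, hp, hRm, hYm⟩
    rwa [S.join_eq hY hm hYm hRm]
  · exact fun h => ⟨_, S.join_mem_lines hY, h, S.right_mem_join hY, S.left_mem_join hY⟩

theorem Shift.symm {X Y : F.Point} {Q R : P} (h : Shift X Y Q R) : Shift Y X R Q := by
  obtain ⟨m, hm, hp, hne, he, hQ⟩ := exists_parallel_of_notMem h.1
  have hR := h.2.1
  rw [he] at hR
  refine ⟨h.right_notMem, ?_, h.2.2.symm⟩
  rwa [S.parallelThrough_eq carrier_mem_lines hm hp hR]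

theorem Shift.trans {X Y Z : F.Point} {Q R T : P} (h : Shift X Y Q R) (h' : Shift Y Z R T) :
    Shift X Z Q T := by
  obtain ⟨m, hm, hp, hne, he, hQ⟩ := exists_parallel_of_notMem h.1
  have hR := h.2.1
  have hT := h'.2.1
  rw [he] at hR
  rw [S.parallelThrough_eq carrier_mem_lines hm hp hR] at hT
  exact ⟨h.1, he ▸ hT, h.2.2.trans (S.join_mem_lines (ne_of_notMem_carrier _ h.1))
    (S.join_mem_lines (ne_of_notMem_carrier _ h.right_notMem))
    (S.join_mem_lines (ne_of_notMem_carrier _ h'.right_notMem)) h'.2.2⟩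

theorem shift_self (X : F.Point) {Q : P} (h : Q ∉ F.carrier) : Shift X X Q Q := by
  obtain ⟨m, hm, hp, hne, he, hQ⟩ := exists_parallel_of_notMem h
  exact ⟨h, he ▸ hQ, Parallel.refl _⟩

theorem exists_shift (X Y : F.Point) {Q : P} (h : Q ∉ F.carrier) : ∃ R, Shift X Y Q R := by
  obtain ⟨m, hm, hp, hne, he, hQ⟩ := exists_parallel_of_notMem h
  have hX := ne_of_notMem_carrier X h
  obtain ⟨R, h1, h2⟩ := S.exists_mem_inter carrier_mem_lines (S.join_mem_lines hX) hm hp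
    (not_parallel X.2 (S.left_mem_join hX) h (S.right_mem_join hX)) Y.1
  rw [← he] at h1
  exact ⟨R, h, h1, (mem_parallelThrough_join_iff
    (notMem_carrier_of_mem_parallelThrough h h1)).1 h2⟩

theorem exists_shift_right (X : F.Point) {Q R : P} (h : Q ∉ F.carrier)
    (hR : R ∈ S.parallelThrough F.carrier Q) : ∃ Y, Shift X Y Q R := by
  obtain ⟨Y, hY, -⟩ := exists_last X h R
  exact ⟨Y, h, hR, (mem_parallelThrough_join_iff'
    (notMem_carrier_of_mem_parallelThrough h hR)).1 hY⟩

theorem Shift.right_unique {X Y Z : F.Point} {Q R : P} (h : Shift X Y Q R)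
    (h' : Shift X Z Q R) : Y = Z := by
  obtain ⟨m, hm, hp, hne, he, hQ⟩ := exists_parallel_of_notMem h.right_notMem
  have := (h.symm.trans h').2.2
  rw [join_comm Y.1, join_comm Z.1] at this
  exact Subtype.ext
    (eq_of_parallel_join carrier_mem_lines hp.symm hne.symm hQ Y.2 Z.2 this)

theorem Shift.eq_iff {X Y : F.Point} {Q R : P} (h : Shift X Y Q R) : X = Y ↔ Q = R := by
  constructor
  · rintro rfl
    obtain ⟨m, hm, hp, hne, he, hQ⟩ := exists_parallel_of_notMem h.1
    have hR := h.2.1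
    rw [he] at hR
    exact eq_of_parallel_join hm hp hne X.2 hQ hR h.2.2
  · rintro rfl
    exact (shift_self X h.1).right_unique h

/-- The auxiliary pair `B₁`, `P₁` represents the translation from `O` to `A`, which is then applied
to `B`. -/
theorem isSum_iff {A B C : F.Point} :
    IsSum A B C ↔ ∃ Q R, Shift 0 A Q R ∧ Shift B C Q R := by
  constructor
  · rintro ⟨Q, R, hQ, ⟨h1, h2⟩, h3, -⟩
    have hR := notMem_carrier_of_mem_parallelThrough hQ h1
    exact ⟨Q, R, ⟨hQ, h1, (mem_parallelThrough_join_iff (X := 0) hR).1 h2⟩, hQ, h1,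
      (mem_parallelThrough_join_iff' hR).1 h3⟩
  · rintro ⟨Q, R, h1, h2⟩
    exact ⟨Q, R, h1.1, ⟨h1.2.1, (mem_parallelThrough_join_iff (X := 0) h1.right_notMem).2
      h1.2.2⟩, (mem_parallelThrough_join_iff' h1.right_notMem).2 h2.2.2, C.2⟩

theorem Shift.transfer_of_notMem (hS : S.IsDesarguesian) {X Y Z W : F.Point} {Q R Q' R' : P}
    (h1 : Shift X Y Q R) (h2 : Shift Z W Q R) (h3 : Shift X Y Q' R')
    (hQ' : Q' ∉ S.parallelThrough F.carrier Q) : Shift Z W Q' R' := by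
  obtain ⟨m, hm, hp, hne, he, hQm⟩ := exists_parallel_of_notMem h1.1
  obtain ⟨n, hn, hp', hne', he', hQn⟩ := exists_parallel_of_notMem h3.1
  have hR := h1.2.1
  have hR' := h3.2.1
  rw [he] at hR hQ'
  rw [he'] at hR'
  have hmn : m ≠ n := fun e => hQ' (e ▸ hQn)
  have hl := carrier_mem_lines (F := F)
  have pmn := hp.symm.trans hm hl hn hp'
  -- Triangles `QXQ'` and `RYR'` give this direction; triangles `ZQQ'` and `WRR'` then carry the
  -- translation over to `Z`, `W`.
  have key : Parallel (S.join Q Q') (S.join R R') := by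
    refine little_desargues hS hm hl hn hp.symm hp' hne.symm hne' hmn hQm hR X.2 Y.2 hQn hR' ?_
      h3.2.2
    rw [join_comm Q, join_comm R]
    exact h1.2.2
  exact ⟨h3.1, h3.2.1, little_desargues hS hl hm hn hp pmn hne hmn hne' Z.2 W.2 hQm hR hQn hR'
    h2.2.2 key⟩

/-- The translation along `OI` induced by an auxiliary pair of points does not depend on the
pair. -/
theorem Shift.transfer (hS : S.IsDesarguesian) {X Y Z W : F.Point} {Q R Q' R' : P}
    (h1 : Shift X Y Q R) (h2 : Shift Z W Q R) (h3 : Shift X Y Q' R') : Shift Z W Q' R' := by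
  by_cases hQ' : Q' ∈ S.parallelThrough F.carrier Q
  swap
  · exact h1.transfer_of_notMem hS h2 h3 hQ'
  obtain ⟨m, hm, hp, hne, he, hQm⟩ := exists_parallel_of_notMem h1.1
  have he' := hQ'
  rw [he] at he'
  have he' := S.parallelThrough_eq carrier_mem_lines hm hp he'
  have hR' := h3.2.1
  -- Both pairs lie on `m`, so the comparison passes through a pair on a third parallel, if there is
  -- one.
  by_cases hT : ∃ T, T ∉ F.carrier ∧ T ∉ m
  · obtain ⟨T, hT, hTm⟩ := hT
    obtain ⟨T', h4⟩ := exists_shift X Y hT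
    have h5 := h1.transfer_of_notMem hS h2 h4 (by rwa [he])
    refine h4.transfer_of_notMem hS h5 h3 fun hmem => hTm ?_
    obtain ⟨n, hn, hp', hne', hen, hTn⟩ := exists_parallel_of_notMem hT
    rw [hen] at hmem
    rw [he] at hQ'
    rwa [((hp.symm.trans hm carrier_mem_lines hn hp').eq_of_mem hQ' hmem)]
  -- Here the two parallels exhaust the plane. The lines `ZQ'` and `WR'` could meet only on one of
  -- them, which would force `Z = W` or `Q' = R'`.
  · push Not at hT
    by_cases hZW : Z = W
    · subst hZW
      obtain rfl := h3.eq_iff.1 (h1.eq_iff.2 (h2.eq_iff.1 rfl))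
      exact shift_self Z h3.1
    · have hQR : Q' ≠ R' := fun e => hZW (h2.eq_iff.2 (h1.eq_iff.1 (h3.eq_iff.2 e)))
      rw [he'] at hR'
      rw [he] at hQ'
      have hZ := ne_of_notMem_carrier Z h3.1
      have hW := ne_of_notMem_carrier W h3.right_notMem
      refine ⟨h3.1, h3.2.1, parallel_of_forall_eq fun V hV hV' => ?_⟩
      by_cases hVl : V ∈ F.carrier
      · have e1 := eq_of_mem_transversal carrier_mem_lines (S.join_mem_lines hZ) hp.symm hne.symm
          hQ' Z.2 hVl (S.right_mem_join hZ) (S.left_mem_join hZ) hV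
        have e2 := eq_of_mem_transversal carrier_mem_lines (S.join_mem_lines hW) hp.symm hne.symm
          hR' W.2 hVl (S.right_mem_join hW) (S.left_mem_join hW) hV'
        exact absurd (Subtype.ext (e1.trans e2.symm)) hZW
      · have e1 := eq_of_mem_transversal hm (S.join_mem_lines hZ) hp hne
          Z.2 hQ' (hT V hVl) (S.left_mem_join hZ) (S.right_mem_join hZ) hV
        have e2 := eq_of_mem_transversal hm (S.join_mem_lines hW) hp hne
          W.2 hR' (hT V hVl) (S.left_mem_join hW) (S.right_mem_join hW) hV'
        exact absurd (e1.trans e2.symm) hQR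

/-! ### The group of points under addition -/

theorem Shift.add (hS : S.IsDesarguesian) {A : F.Point} {Q R : P} (h : Shift 0 A Q R)
    (B : F.Point) : Shift B (A + B) Q R := by
  obtain ⟨Q', R', h1, h2⟩ := isSum_iff.1 (Classical.choose_spec (exists_isSum A B))
  exact h1.transfer hS h2 h

theorem Shift.add_eq (hS : S.IsDesarguesian) {A B C : F.Point} {Q R : P} (h : Shift 0 A Q R)
    (h' : Shift B C Q R) : A + B = C :=
  (h.add hS B).right_unique h'

theorem point_add_zero (hS : S.IsDesarguesian) (A : F.Point) : A + 0 = A := by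
  obtain ⟨Q, hQ⟩ := S.exists_notMem (carrier_mem_lines (F := F))
  obtain ⟨R, h⟩ := exists_shift 0 A hQ
  exact h.add_eq hS h

theorem point_zero_add (hS : S.IsDesarguesian) (A : F.Point) : 0 + A = A := by
  obtain ⟨Q, hQ⟩ := S.exists_notMem (carrier_mem_lines (F := F))
  exact (shift_self 0 hQ).add_eq hS (shift_self A hQ)

theorem point_add_assoc (hS : S.IsDesarguesian) (A B C : F.Point) :
    A + B + C = A + (B + C) := by
  obtain ⟨Q, hQ⟩ := S.exists_notMem (carrier_mem_lines (F := F))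
  obtain ⟨R, h⟩ := exists_shift 0 B hQ
  obtain ⟨T, h'⟩ := exists_shift 0 A h.right_notMem
  exact (h.trans (h'.add hS B)).add_eq hS ((h.add hS C).trans (h'.add hS (B + C)))

theorem exists_point_add_eq_zero (hS : S.IsDesarguesian) (A : F.Point) :
    ∃ B : F.Point, A + B = 0 := by
  obtain ⟨Q, hQ⟩ := S.exists_notMem (carrier_mem_lines (F := F))
  obtain ⟨R, h⟩ := exists_shift 0 A hQ
  obtain ⟨B, h'⟩ := exists_shift_right 0 h.right_notMem h.symm.2.1
  exact ⟨B, h.add_eq hS h'.symm⟩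

/-- The usual monoid argument with a right inverse of `B`; commutativity is not yet available, and
`-A` is chosen as a two-sided inverse. -/
theorem point_add_eq_zero_symm (hS : S.IsDesarguesian) {A B : F.Point} (h : A + B = 0) :
    B + A = 0 := by
  obtain ⟨C, hC⟩ := exists_point_add_eq_zero hS B
  have : A = C := by
    rw [← point_add_zero hS A, ← hC, ← point_add_assoc hS, h, point_zero_add hS]
  rwa [this]

theorem point_sub_self (hS : S.IsDesarguesian) (A : F.Point) : A - A = 0 := by
  obtain ⟨B, hB⟩ := exists_point_add_eq_zero hS A
  exact (Classical.epsilon_spec (p := fun Z : F.Point => A + Z = 0 ∧ Z + A = 0)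
    ⟨B, hB, point_add_eq_zero_symm hS hB⟩).1

theorem point_add_comm (hS : S.IsDesarguesian) (A B : F.Point) : A + B = B + A := by
  -- In these three cases some of the parallels used below would coincide.
  by_cases hC : A + B = 0
  · rw [hC, point_add_eq_zero_symm hS hC]
  by_cases hA : A = 0
  · rw [hA, point_zero_add hS, point_add_zero hS]
  by_cases hB : B = 0
  · rw [hB, point_zero_add hS, point_add_zero hS]
  obtain ⟨Q, hQ⟩ := S.exists_notMem (carrier_mem_lines (F := F))
  obtain ⟨T, h1⟩ := exists_shift 0 A hQ
  have h2 := h1.add hS B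
  obtain ⟨R, h3⟩ := exists_shift A (A + B) h1.right_notMem
  -- By `h3` the pair `T`, `R` takes `A` to `A + B`; if it also represents `B`, the same figure
  -- computes `B + A`.
  suffices h : Shift 0 B T R from (h.add_eq hS h3).symm
  generalize A + B = C at *
  have hBC : B ≠ C := fun e => hA (h1.eq_iff.2 (h2.eq_iff.1 e)).symm
  obtain ⟨m, hm, hp, hne, he, hQm⟩ := exists_parallel_of_notMem hQ
  have hTm := h1.2.1
  have hRm := (h1.trans h3).2.1
  rw [he] at hTm hRm
  have hl := carrier_mem_lines (F := F)
  have nO := ne_of_notMem_carrier (0 : F.Point) hQ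
  have nB := ne_of_notMem_carrier B hQ
  have nC := ne_of_notMem_carrier C h1.right_notMem
  have nC' := ne_of_notMem_carrier C h3.right_notMem
  have jO := S.join_mem_lines nO
  have jB := S.join_mem_lines nB
  have jC := S.join_mem_lines nC
  have jC' := S.join_mem_lines nC'
  have meet : ∀ {X Y : F.Point} {V : P} {k : Set P}, V ∉ F.carrier → k ∈ S.lines → V ∈ k →
      X.1 ∈ k → Y.1 ∈ k → X = Y := by
    intro X Y V k hV hk hVk hX hY
    by_contra hXY
    exact hV (line_eq (fun e => hXY (Subtype.ext e)) hl hk X.2 Y.2 hX hY ▸ hVk)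
  have hOB : Parallel (S.join (0 : F.Point).1 Q) (S.join C.1 R) := (h1.trans h3).2.2
  -- `D` completes the parallelogram with sides `OQ` and `QB`.
  obtain ⟨d, ⟨hd, hpd, hOd⟩, -⟩ := S.existsUnique_parallel jB (0 : F.Point).1
  obtain ⟨e, ⟨he', hpe, hBe⟩, -⟩ := S.existsUnique_parallel jO B.1
  have hde : ¬ Parallel d e := by
    intro hde
    have h4 : Parallel (S.join B.1 Q) (S.join (0 : F.Point).1 Q) :=
      (hpd.trans jB hd he' hde).trans jB he' jO hpe.symm
    have h5 := h4.eq_of_mem (S.right_mem_join nB) (S.right_mem_join nO)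
    exact hB (meet hQ jB (S.right_mem_join nB) (S.left_mem_join nB)
      (h5 ▸ S.left_mem_join nO))
  obtain ⟨D, hDd, hDe⟩ : ∃ D, D ∈ d ∧ D ∈ e := by
    by_contra hcon
    exact hde (Or.inr (Set.eq_empty_iff_forall_notMem.2 fun X hX => hcon ⟨X, hX⟩))
  have neBd : S.join B.1 Q ≠ d := fun h =>
    hB (meet hQ jB (S.right_mem_join nB) (S.left_mem_join nB) (h ▸ hOd))
  have neBC : S.join B.1 Q ≠ S.join C.1 T := fun h => hBC
    (meet hQ jB (S.right_mem_join nB) (S.left_mem_join nB) (h ▸ S.left_mem_join nC))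
  have pdC : Parallel d (S.join C.1 T) := hpd.symm.trans hd jB jC h2.2.2
  have nedC : d ≠ S.join C.1 T := fun h => hC
    (meet h1.right_notMem jC (S.right_mem_join nC) (S.left_mem_join nC) (h ▸ hOd))
  have nBD : B.1 ≠ D := fun h => neBd (hpd.eq_of_mem (S.left_mem_join nB) (h ▸ hDd))
  have nOD : (0 : F.Point).1 ≠ D := by
    intro h
    have h5 := hpe.eq_of_mem (S.left_mem_join nO) (h ▸ hDe)
    exact hB (meet hQ jO (S.right_mem_join nO) (h5 ▸ hBe) (S.left_mem_join nO))
  have nCD : C.1 ≠ D := fun h => nedC (pdC.eq_of_mem (h ▸ hDd) (S.left_mem_join nC))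
  have nQT : Q ≠ T := fun h => hA (h1.eq_iff.2 h).symm
  have neOe : S.join (0 : F.Point).1 Q ≠ e := fun h =>
    hB (meet hQ jO (S.right_mem_join nO) (h ▸ hBe) (S.left_mem_join nO))
  have neOC : S.join (0 : F.Point).1 Q ≠ S.join C.1 R := fun h =>
    hC (meet hQ jO (S.right_mem_join nO) (h ▸ S.left_mem_join nC') (S.left_mem_join nO))
  have neeC : e ≠ S.join C.1 R := fun h =>
    hBC (meet h3.right_notMem jC' (S.right_mem_join nC') (h ▸ hBe) (S.left_mem_join nC'))
  have hBC' : B.1 ≠ C.1 := fun h => hBC (Subtype.ext h)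
  have hOC' : (0 : F.Point).1 ≠ C.1 := fun h => hC (Subtype.ext h.symm)
  have nQR : Q ≠ R := fun h => hC ((h1.trans h3).eq_iff.2 h).symm
  have hDB : S.join D B.1 = e := S.join_eq nBD.symm he' hDe hBe
  -- Little Desargues along the direction `QB`: triangle `OQT` goes to `DBC`.
  have key1 : Parallel (S.join (0 : F.Point).1 T) (S.join D C.1) := by
    refine little_desargues hS hd jB jC hpd.symm h2.2.2 neBd.symm neBC nedC hOd hDd
      (S.right_mem_join nB) (S.left_mem_join nB) (S.right_mem_join nC) (S.left_mem_join nC) ?_ ?_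
    · rwa [hDB]
    · rw [S.join_eq nQT hm hQm hTm, S.join_eq hBC' hl B.2 C.2]
      exact hp.symm
  -- Little Desargues along the direction `OQ`: triangle `DOC` goes to `BQR`.
  have key2 : Parallel (S.join D C.1) (S.join B.1 R) := by
    refine little_desargues hS he' jO jC' hpe.symm hOB neOe.symm neOC neeC hDe hBe
      (S.left_mem_join nO) (S.right_mem_join nO) (S.left_mem_join nC') (S.right_mem_join nC') ?_ ?_
    · rw [join_comm D, S.join_eq nOD hd hOd hDd]
      exact hpd.symm
    · rw [S.join_eq nQR hm hQm hRm, S.join_eq hOC' hl (0 : F.Point).2 C.2]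
      exact hp
  exact ⟨h1.right_notMem, h3.2.1, key1.trans
    (S.join_mem_lines (ne_of_notMem_carrier _ h1.right_notMem)) (S.join_mem_lines nCD.symm)
    (S.join_mem_lines (ne_of_notMem_carrier _ h3.right_notMem)) key2⟩

/-! ### Products with `O` and the zeros of the cross-ratio map -/

/-- The last line drawn is `OB₁` itself, because `P₁` already lies on it, and it meets `OI` only in
`O`. -/
theorem point_mul_zero (A : F.Point) : A * 0 = 0 := by
  obtain ⟨Q, R, hQ, ⟨-, hR⟩, hC, -⟩ := Classical.choose_spec (exists_isProd A 0)
  change (A * 0).1 ∈ _ at hC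
  have nO := ne_of_notMem_carrier (0 : F.Point) hQ
  change R ∈ S.join (0 : F.Point).1 Q at hR
  rw [S.parallelThrough_eq (S.join_mem_lines nO) (S.join_mem_lines nO) (Parallel.refl _) hR] at hC
  by_contra hne
  exact hQ (line_eq (fun e => hne (Subtype.ext e)) (S.join_mem_lines nO) carrier_mem_lines hC
    (S.left_mem_join nO) (A * 0).2 (0 : F.Point).2 ▸ S.right_mem_join nO)

/-- The parallel to `IB₁` through `O` meets `OB₁` only in `O`, so `P₁ = O`, and the last line meets
`OI` there. -/
theorem point_zero_mul (A : F.Point) : 0 * A = 0 := by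
  obtain ⟨Q, R, hQ, ⟨⟨k, hk, hpk, hOk, hRk⟩, hR⟩, hC, -⟩ :=
    Classical.choose_spec (exists_isProd 0 A)
  change (0 * A).1 ∈ _ at hC
  have nO := ne_of_notMem_carrier (0 : F.Point) hQ
  have nI := ne_of_notMem_carrier (1 : F.Point) hQ
  have nA := ne_of_notMem_carrier A hQ
  have hRO : R = (0 : F.Point).1 := by
    by_contra hne
    have hkO : k = S.join (0 : F.Point).1 Q :=
      line_eq hne hk (S.join_mem_lines nO) hRk hOk hR (S.left_mem_join nO)
    subst hkO
    have h := hpk.eq_of_mem (S.right_mem_join nI) (S.right_mem_join nO)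
    have hI : F.I ∈ S.join (0 : F.Point).1 Q := h ▸ S.left_mem_join nI
    exact hQ (line_eq F.ne carrier_mem_lines hk (0 : F.Point).2 (1 : F.Point).2 hOk hI ▸
      S.right_mem_join nO)
  obtain ⟨j, hj, hpj, hRj, hCj⟩ := hC
  by_contra hne
  have hjl : F.carrier = j := line_eq (fun e => hne (Subtype.ext e)) carrier_mem_lines hj
    (0 * A).2 (0 : F.Point).2 hCj (hRO ▸ hRj)
  exact hQ (hjl ▸ hpj.eq_of_mem (S.left_mem_join nA) (hjl ▸ A.2) ▸ S.right_mem_join nA)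

theorem point_inv_zero : (0 : F.Point)⁻¹ = 0 := if_pos rfl

theorem fB_right (hS : S.IsDesarguesian) (A C D : F.Point) : fB A C D D = 0 := by
  rw [fB, crossRatio, point_sub_self hS, point_mul_zero, point_zero_mul]

theorem fB_left (hS : S.IsDesarguesian) (A C D : F.Point) : fB A C D C = 0 := by
  rw [fB, crossRatio, point_sub_self hS C, point_inv_zero, point_zero_mul, point_mul_zero]

end Frame

end AffinePlane

theorem theorem2p4 {P : Type*} (S : AffinePlane P) (hS : S.IsDesarguesian) (F : S.Frame)
    (A C D : F.Point) (hAC : A ≠ C) (hAD : A ≠ D) (hCD : C ≠ D)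
    (hA : A ≠ 0) (hC : C ≠ 0) (hD : D ≠ 0) :
    (∀ U ∈ AffinePlane.Frame.mapSetB A C D, ∀ V ∈ AffinePlane.Frame.mapSetB A C D,
      ∀ W ∈ AffinePlane.Frame.mapSetB A C D, (U + V) + W = U + (V + W)) ∧
    (∀ U ∈ AffinePlane.Frame.mapSetB A C D, ∀ V ∈ AffinePlane.Frame.mapSetB A C D,
      U + V = V + U) ∧
    (AffinePlane.Frame.fB A C D C = 0 ∧ AffinePlane.Frame.fB A C D D = 0 ∧
      (0 : F.Point) ∈ AffinePlane.Frame.mapSetB A C D ∧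
      ∀ U ∈ AffinePlane.Frame.mapSetB A C D, U + 0 = U ∧ 0 + U = U) := by
  open AffinePlane.Frame in
  exact ⟨fun U _ V _ W _ => point_add_assoc hS U V W, fun U _ V _ => point_add_comm hS U V,
    fB_left hS A C D, fB_right hS A C D, ⟨D, fB_right hS A C D⟩,
    fun U _ => ⟨point_add_zero hS U, point_zero_add hS U⟩⟩
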